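/- Let $M_2(\mathbb R)$ be the space of real $2\times 2$ matrices with the spectral norm $\|A\|=\max\{\|Ax\|_2: x\in\mathbb R^2,\ \|x\|_2=1\}$. Matrices $A,B$ form a TEA (triangle equality attaining) pair if $\|A+B\|=\|A\|+\|B\|$, and a parallel pair if $\|A+\mu B\|=\|A\|+\|B\|$ for some $\mu\in\{1,-1\}$. A linear map $T$ preserves TEA (resp. parallel) pairs if $T(A),T(B)$ is a TEA (resp. parallel) pair whenever $A,B$ is one. Let $$R_1=\begin{pmatrix}1&0\\0&-1\end{pmatrix},\quad R_2=\begin{pmatrix}0&1\\1&0\end{pmatrix},\quad R_3=\begin{pmatrix}0&1\\-1&0\end{pmatrix},$$ and let $\mathbf R=\{I_2/\sqrt2,\,R_1/\sqrt2,\,R_2/\sqrt2,\,R_3/\sqrt2\}$, an ordered basis of $M_2(\mathbb R)$. Theorem. Let $T:M_2(\mathbb R)\to M_2(\mathbb R)$ be a real linear map. (a) $T$ preserves TEA pairs if and only if at least one of the following holds: (a.1) there are real orthogonal $2\times2$ matrices $F_1,F_2$ with $F_1^{t}F_2=\begin{pmatrix}0&1\\-1&0\end{pmatrix}$ and matrices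 $Z_1,Z_2\in M_2(\mathbb R)$ such that $T(X)=\operatorname{trace}(F_1X)Z_1+\operatorname{trace}(F_2X)Z_2$ for all $X\in M_2(\mathbb R)$; (a.2) there are real orthogonal $2\times2$ matrices $U_1,U_2,V_1,V_2$ such that the linear map $\tilde T(A)=U_1T(U_2AV_2)V_1$ is represented in the basis $\mathbf R$ by a real diagonal matrix $\operatorname{diag}(d_0,d_1,d_2,d_3)$. (b) $T$ preserves parallel pairs if and only if (a.1) holds, or (a.2) holds, or there are $F,Z\in M_2(\mathbb R)$ such that $T(A)=\operatorname{trace}(FA)Z$ for all $A\in M_2(\mathbb R)$. -/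

import Mathlib

open scoped Matrix

/- Matrices carry the spectral norm, i.e. the operator norm induced by the Euclidean norm. -/
open scoped Matrix.Norms.L2Operator

/-- The space `M₂(ℝ)` of real two by two matrices. -/
abbrev M2 : Type := Matrix (Fin 2) (Fin 2) ℝ

/-- Two vectors are parallel if `‖x + μ y‖ = ‖x‖ + ‖y‖` for some scalar `μ` of modulus one. -/
def IsParallelPair (𝕜 : Type*) {V : Type*} [RCLike 𝕜] [NormedAddCommGroup V] [NormedSpace 𝕜 V]
    (x y : V) : Prop :=
  ∃ μ : 𝕜, ‖μ‖ = 1 ∧ ‖x + μ • y‖ = ‖x‖ + ‖y‖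

/-- Two vectors form a triangle equality attaining (TEA) pair if `‖x + y‖ = ‖x‖ + ‖y‖`. -/
def IsTEAPair {V : Type*} [NormedAddCommGroup V] (x y : V) : Prop :=
  ‖x + y‖ = ‖x‖ + ‖y‖

/-- `T` maps parallel pairs to parallel pairs (for the spectral norm). -/
def PreservesParallelPairs (T : M2 →ₗ[ℝ] M2) : Prop :=
  ∀ A B : M2, IsParallelPair ℝ A B → IsParallelPair ℝ (T A) (T B)

/-- `T` maps TEA pairs to TEA pairs (for the spectral norm). -/
def PreservesTEAPairs (T : M2 →ₗ[ℝ] M2) : Prop :=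
  ∀ A B : M2, IsTEAPair A B → IsTEAPair (T A) (T B)

/-- The family `I/√2, R₁/√2, R₂/√2, R₃/√2`. -/
noncomputable def familyR : Fin 4 → M2 :=
  ![(1 / √2 : ℝ) • !![1, 0; 0, 1], (1 / √2 : ℝ) • !![1, 0; 0, -1],
    (1 / √2 : ℝ) • !![0, 1; 1, 0], (1 / √2 : ℝ) • !![0, 1; -1, 0]]

theorem familyR_linearIndependent : LinearIndependent ℝ familyR := by
  rw [Fintype.linearIndependent_iff]
  intro g hg
  have h2 : (√2 : ℝ)⁻¹ ≠ 0 := by positivity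
  have h00 := congrFun (congrFun hg 0) 0
  have h01 := congrFun (congrFun hg 0) 1
  have h10 := congrFun (congrFun hg 1) 0
  have h11 := congrFun (congrFun hg 1) 1
  simp only [Fin.sum_univ_four, familyR] at h00 h01 h10 h11
  simp at h00 h01 h10 h11
  have e0 : g 0 = 0 := mul_right_cancel₀ h2 (by linarith)
  have e1 : g 1 = 0 := mul_right_cancel₀ h2 (by linarith)
  have e2 : g 2 = 0 := mul_right_cancel₀ h2 (by linarith)
  have e3 : g 3 = 0 := mul_right_cancel₀ h2 (by linarith)
  intro i
  fin_cases i <;> assumption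

/-- The ordered basis `I/√2, R₁/√2, R₂/√2, R₃/√2` of `M₂(ℝ)`. -/
noncomputable def basisR : Module.Basis (Fin 4) ℝ M2 :=
  basisOfLinearIndependentOfCardEqFinrank familyR_linearIndependent
    (by simp [Module.finrank_matrix])

/-- `T(X) = trace(F₁ X) Z₁ + trace(F₂ X) Z₂` with `F₁`, `F₂` real orthogonal and
`F₁ᵀ F₂` equal to the rotation matrix below. -/
def HasTwoTraceForm (T : M2 →ₗ[ℝ] M2) : Prop :=
  ∃ F₁ ∈ Matrix.orthogonalGroup (Fin 2) ℝ, ∃ F₂ ∈ Matrix.orthogonalGroup (Fin 2) ℝ,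
    F₁ᵀ * F₂ = !![0, 1; -1, 0] ∧
    ∃ Z₁ Z₂ : M2, ∀ X : M2, T X = (F₁ * X).trace • Z₁ + (F₂ * X).trace • Z₂

/-- The map `A ↦ U₁ * T (U₂ * A * V₂) * V₁`. -/
noncomputable def modifiedMap (T : M2 →ₗ[ℝ] M2) (U₁ U₂ V₁ V₂ : M2) : M2 →ₗ[ℝ] M2 :=
  LinearMap.mulLeftRight ℝ (U₁, V₁) ∘ₗ T ∘ₗ LinearMap.mulLeftRight ℝ (U₂, V₂)

theorem modifiedMap_apply (T : M2 →ₗ[ℝ] M2) (U₁ U₂ V₁ V₂ A : M2) :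
    modifiedMap T U₁ U₂ V₁ V₂ A = U₁ * T (U₂ * A * V₂) * V₁ := by
  simp [modifiedMap]

/-- For some real orthogonal `U₁, U₂, V₁, V₂` the map `A ↦ U₁ * T (U₂ * A * V₂) * V₁` is
represented by a diagonal matrix in the basis `I/√2, R₁/√2, R₂/√2, R₃/√2`. -/
def HasDiagonalForm (T : M2 →ₗ[ℝ] M2) : Prop :=
  ∃ U₁ ∈ Matrix.orthogonalGroup (Fin 2) ℝ, ∃ U₂ ∈ Matrix.orthogonalGroup (Fin 2) ℝ,
  ∃ V₁ ∈ Matrix.orthogonalGroup (Fin 2) ℝ, ∃ V₂ ∈ Matrix.orthogonalGroup (Fin 2) ℝ,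
  ∃ d : Fin 4 → ℝ,
    LinearMap.toMatrix basisR basisR (modifiedMap T U₁ U₂ V₁ V₂) = Matrix.diagonal d

/-- `T(A) = trace(F A) Z` for some real matrices `F`, `Z`. -/
def HasOneTraceForm (T : M2 →ₗ[ℝ] M2) : Prop :=
  ∃ F Z : M2, ∀ A : M2, T A = (F * A).trace • Z

/-! A real matrix acts on the plane as `z ↦ α z + β z̄`, and its spectral norm is `|α| + |β|`. So
`M₂(ℝ)` is the ℓ¹-sum of two Euclidean planes, and a pair is TEA exactly when both its α-parts and
its β-parts lie on a common ray (`isTEAPair_iff_sameRay`).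

Let `L` be either component of `T`. If `T` preserves TEA pairs, `L α` shares a ray with `L β` for
all signs, so `L` kills one of the planes (`comp_eq_zero_or_of_sameRay`). If both components kill
the same plane, `T` factors through the other one, which is the two-trace form. Otherwise `T` is
block diagonal, possibly after a reflection, and a singular value decomposition of each block gives
the diagonal form.

If `T` only preserves parallel pairs and some component is nonzero on both planes, that component
has rank one, and a perturbation argument forces the other component to be a multiple of the same
functional (`exists_common_functional`); this is the one-trace form. -/

open scoped ComplexConjugate

/-! ### Conformal and anticonformal coordinates -/

/-- The `ℂ`-linear part `α` of the real linear map `z ↦ α z + β z̄` of the plane given by a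
matrix. -/
noncomputable def conformalPart : M2 →ₗ[ℝ] ℂ where
  toFun A := ⟨(A 0 0 + A 1 1) / 2, (A 1 0 - A 0 1) / 2⟩
  map_add' A B := by apply Complex.ext <;> simp <;> ring
  map_smul' c A := by apply Complex.ext <;> simp <;> ring

/-- The `ℂ`-antilinear part `β` of the real linear map `z ↦ α z + β z̄` of the plane given by a
matrix. -/
noncomputable def anticonformalPart : M2 →ₗ[ℝ] ℂ where
  toFun A := ⟨(A 0 0 - A 1 1) / 2, (A 1 0 + A 0 1) / 2⟩
  map_add' A B := by apply Complex.ext <;> simp <;> ring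
  map_smul' c A := by apply Complex.ext <;> simp <;> ring

/-- The matrix of `z ↦ α z`. -/
noncomputable def ofConformal : ℂ →ₗ[ℝ] M2 where
  toFun z := !![z.re, -z.im; z.im, z.re]
  map_add' z w := by ext i j; fin_cases i <;> fin_cases j <;> simp; ring
  map_smul' c z := by ext i j; fin_cases i <;> fin_cases j <;> simp

/-- The matrix of `z ↦ β z̄`. -/
noncomputable def ofAnticonformal : ℂ →ₗ[ℝ] M2 where
  toFun z := !![z.re, z.im; z.im, -z.re]
  map_add' z w := by ext i j; fin_cases i <;> fin_cases j <;> simp; ring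
  map_smul' c z := by ext i j; fin_cases i <;> fin_cases j <;> simp

theorem conformalPart_apply (A : M2) :
    conformalPart A = ⟨(A 0 0 + A 1 1) / 2, (A 1 0 - A 0 1) / 2⟩ := rfl

theorem anticonformalPart_apply (A : M2) :
    anticonformalPart A = ⟨(A 0 0 - A 1 1) / 2, (A 1 0 + A 0 1) / 2⟩ := rfl

theorem ofConformal_apply (z : ℂ) : ofConformal z = !![z.re, -z.im; z.im, z.re] := rfl

theorem ofAnticonformal_apply (z : ℂ) : ofAnticonformal z = !![z.re, z.im; z.im, -z.re] := rfl

@[simp] theorem conformalPart_ofConformal (z : ℂ) : conformalPart (ofConformal z) = z := by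
  apply Complex.ext <;> simp [conformalPart_apply, ofConformal_apply]

@[simp] theorem anticonformalPart_ofConformal (z : ℂ) :
    anticonformalPart (ofConformal z) = 0 := by
  apply Complex.ext <;> simp [anticonformalPart_apply, ofConformal_apply]

@[simp] theorem conformalPart_ofAnticonformal (z : ℂ) :
    conformalPart (ofAnticonformal z) = 0 := by
  apply Complex.ext <;> simp [conformalPart_apply, ofAnticonformal_apply]

@[simp] theorem anticonformalPart_ofAnticonformal (z : ℂ) :
    anticonformalPart (ofAnticonformal z) = z := by
  apply Complex.ext <;> simp [anticonformalPart_apply, ofAnticonformal_apply]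

theorem ofConformal_add_ofAnticonformal (A : M2) :
    ofConformal (conformalPart A) + ofAnticonformal (anticonformalPart A) = A := by
  ext i j
  fin_cases i <;> fin_cases j <;>
    simp [conformalPart_apply, anticonformalPart_apply, ofConformal_apply,
      ofAnticonformal_apply] <;> ring

theorem M2.ext_parts {A B : M2} (hp : conformalPart A = conformalPart B)
    (hq : anticonformalPart A = anticonformalPart B) : A = B := by
  rw [← ofConformal_add_ofAnticonformal A, hp, hq, ofConformal_add_ofAnticonformal]

/-! ### The spectral norm and TEA pairs in these coordinates -/

theorem norm_toLp_eq_norm_complex (x y : ℝ) :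
    ‖WithLp.toLp 2 ![x, y]‖ = ‖(⟨x, y⟩ : ℂ)‖ := by
  rw [EuclideanSpace.norm_eq, Complex.norm_def, Complex.normSq_mk]
  simp [Fin.sum_univ_two, sq]

theorem norm_mulVec_eq (A : M2) (z : ℂ) :
    ‖WithLp.toLp 2 (A *ᵥ ![z.re, z.im])‖ =
      ‖conformalPart A * z + anticonformalPart A * conj z‖ := by
  have h : A *ᵥ ![z.re, z.im] =
      ![A 0 0 * z.re + A 0 1 * z.im, A 1 0 * z.re + A 1 1 * z.im] := by
    ext i; fin_cases i <;> simp [Matrix.mulVec, dotProduct, Fin.sum_univ_two]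
  rw [h, norm_toLp_eq_norm_complex]
  congr 1
  apply Complex.ext <;> simp [conformalPart_apply, anticonformalPart_apply] <;> ring

/-- Taking `arg z = (arg β - arg α) / 2` gives both products the argument `(arg α + arg β) / 2`. In
this direction a matrix attains its norm. -/
theorem exists_sameRay_mul_mul_conj (α β : ℂ) :
    ∃ z : ℂ, ‖z‖ = 1 ∧ SameRay ℝ (α * z) (β * conj z) := by
  refine ⟨Complex.exp (((β.arg - α.arg) / 2 : ℝ) * Complex.I),
    Complex.norm_exp_ofReal_mul_I _, ?_⟩
  have hα := Complex.norm_mul_exp_arg_mul_I α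
  have hβ := Complex.norm_mul_exp_arg_mul_I β
  have e1 : Complex.exp (α.arg * Complex.I) *
      Complex.exp (((β.arg - α.arg) / 2 : ℝ) * Complex.I) =
      Complex.exp (((β.arg + α.arg) / 2 : ℝ) * Complex.I) := by
    rw [← Complex.exp_add]
    congr 1; push_cast; ring
  have e2 : Complex.exp (β.arg * Complex.I) *
      Complex.exp (((β.arg - α.arg) / 2 : ℝ) * -Complex.I) =
      Complex.exp (((β.arg + α.arg) / 2 : ℝ) * Complex.I) := by
    rw [← Complex.exp_add]
    congr 1; push_cast; ring
  have h1 : α * Complex.exp (((β.arg - α.arg) / 2 : ℝ) * Complex.I) =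
      ‖α‖ • Complex.exp (((β.arg + α.arg) / 2 : ℝ) * Complex.I) := by
    rw [Complex.real_smul, ← e1, ← mul_assoc, hα]
  have h2 : β * conj (Complex.exp (((β.arg - α.arg) / 2 : ℝ) * Complex.I)) =
      ‖β‖ • Complex.exp (((β.arg + α.arg) / 2 : ℝ) * Complex.I) := by
    rw [Complex.real_smul, ← e2, ← mul_assoc, hβ, ← Complex.exp_conj, map_mul, Complex.conj_I,
      Complex.conj_ofReal]
  rw [h1, h2]
  exact ((SameRay.refl _).nonneg_smul_left (norm_nonneg _)).nonneg_smul_right (norm_nonneg _)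

/-- The spectral norm is the sum of the moduli of the conformal and the anticonformal part. -/
theorem norm_eq_norm_conformalPart_add (A : M2) :
    ‖A‖ = ‖conformalPart A‖ + ‖anticonformalPart A‖ := by
  apply le_antisymm
  · rw [Matrix.l2_opNorm_def]
    refine ContinuousLinearMap.opNorm_le_bound _ (by positivity) fun v => ?_
    obtain ⟨z, rfl⟩ : ∃ z : ℂ, v = WithLp.toLp 2 ![z.re, z.im] :=
      ⟨⟨v 0, v 1⟩, by ext i; fin_cases i <;> simp⟩
    have h := norm_mulVec_eq A z
    have hz := norm_toLp_eq_norm_complex z.re z.im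
    rw [hz]
    refine (le_of_eq ?_).trans ((norm_add_le (conformalPart A * z)
      (anticonformalPart A * conj z)).trans (le_of_eq ?_))
    · rw [← h]; rfl
    · simp [add_mul]
  · obtain ⟨z, hz, hray⟩ := exists_sameRay_mul_mul_conj (conformalPart A) (anticonformalPart A)
    have h := Matrix.l2_opNorm_mulVec A (WithLp.toLp 2 ![z.re, z.im])
    have h' := norm_mulVec_eq A z
    rw [hray.norm_add] at h'
    have hz' : ‖WithLp.toLp 2 ![z.re, z.im]‖ = 1 := (norm_toLp_eq_norm_complex _ _).trans hz
    rw [hz', mul_one] at h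
    simp only [norm_mul, RCLike.norm_conj, hz, mul_one] at h'
    rw [← h']
    exact h

/-- Equality in an ℓ¹-sum forces equality in each summand, and `ℂ` is strictly convex. -/
theorem isTEAPair_iff_sameRay (A B : M2) :
    IsTEAPair A B ↔ SameRay ℝ (conformalPart A) (conformalPart B) ∧
      SameRay ℝ (anticonformalPart A) (anticonformalPart B) := by
  rw [IsTEAPair, norm_eq_norm_conformalPart_add, norm_eq_norm_conformalPart_add A,
    norm_eq_norm_conformalPart_add B, sameRay_iff_norm_add, sameRay_iff_norm_add, map_add, map_add]
  have h1 := norm_add_le (conformalPart A) (conformalPart B)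
  have h2 := norm_add_le (anticonformalPart A) (anticonformalPart B)
  constructor
  · intro h; constructor <;> linarith
  · rintro ⟨h, h'⟩; linarith

theorem isTEAPair_ofConformal_ofAnticonformal {α β : ℂ} :
    IsTEAPair (ofConformal α) (ofAnticonformal β) := by
  simp [isTEAPair_iff_sameRay]

theorem IsTEAPair.of_sameRay {A B : M2} (h : SameRay ℝ A B) : IsTEAPair A B := h.norm_add

theorem isParallelPair_iff (A B : M2) :
    IsParallelPair ℝ A B ↔ ∃ μ : ℝ, ‖μ‖ = 1 ∧ IsTEAPair A (μ • B) := by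
  refine exists_congr fun μ => and_congr_right fun hμ => ?_
  rw [IsTEAPair, norm_smul, hμ, one_mul]

/-! ### Trace forms preserve pairs -/

theorem PreservesTEAPairs.preservesParallelPairs {T : M2 →ₗ[ℝ] M2} (h : PreservesTEAPairs T) :
    PreservesParallelPairs T := by
  intro A B hAB
  rw [isParallelPair_iff] at hAB ⊢
  obtain ⟨μ, hμ, hAB⟩ := hAB
  exact ⟨μ, hμ, by simpa using h _ _ hAB⟩

theorem HasOneTraceForm.preservesParallelPairs {T : M2 →ₗ[ℝ] M2} (h : HasOneTraceForm T) :
    PreservesParallelPairs T := by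
  obtain ⟨F, Z, hT⟩ := h
  intro A B _
  rw [isParallelPair_iff, hT, hT]
  set a := (F * A).trace
  set b := (F * B).trace
  rcases le_total 0 (a * b) with hab | hab
  · refine ⟨1, by simp, IsTEAPair.of_sameRay ?_⟩
    rw [one_smul]
    rcases mul_nonneg_iff.1 hab with ⟨ha, hb⟩ | ⟨ha, hb⟩
    · exact ((SameRay.refl _).nonneg_smul_left ha).nonneg_smul_right hb
    · rw [← neg_smul_neg a, ← neg_smul_neg b]
      exact ((SameRay.refl _).nonneg_smul_left (by linarith)).nonneg_smul_right (by linarith)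
  · refine ⟨-1, by simp, IsTEAPair.of_sameRay ?_⟩
    rw [smul_smul]
    rcases mul_nonpos_iff.1 hab with ⟨ha, hb⟩ | ⟨ha, hb⟩
    · exact ((SameRay.refl _).nonneg_smul_left ha).nonneg_smul_right (by linarith)
    · rw [← neg_smul_neg a, ← neg_smul_neg (-1 * b)]
      exact ((SameRay.refl _).nonneg_smul_left (by linarith)).nonneg_smul_right (by linarith)

theorem preservesTEAPairs_of_eq_comp_conformalPart {T : M2 →ₗ[ℝ] M2} (S : ℂ →ₗ[ℝ] M2)
    (h : T = S ∘ₗ conformalPart) : PreservesTEAPairs T := by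
  intro A B hAB
  rw [isTEAPair_iff_sameRay] at hAB
  rw [h]
  exact IsTEAPair.of_sameRay (hAB.1.map S)

theorem preservesTEAPairs_of_eq_comp_anticonformalPart {T : M2 →ₗ[ℝ] M2} (S : ℂ →ₗ[ℝ] M2)
    (h : T = S ∘ₗ anticonformalPart) : PreservesTEAPairs T := by
  intro A B hAB
  rw [isTEAPair_iff_sameRay] at hAB
  rw [h]
  exact IsTEAPair.of_sameRay (hAB.2.map S)

/-- An orthogonal matrix is conformal or anticonformal. -/
theorem parts_of_mem_orthogonalGroup {F : M2} (hF : F ∈ Matrix.orthogonalGroup (Fin 2) ℝ) :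
    anticonformalPart F = 0 ∨ conformalPart F = 0 := by
  rw [Matrix.mem_orthogonalGroup_iff] at hF
  have h00 := congrFun (congrFun hF 0) 0
  have h01 := congrFun (congrFun hF 0) 1
  have h11 := congrFun (congrFun hF 1) 1
  simp [Matrix.mul_apply, Fin.sum_univ_two] at h00 h01 h11
  rw [← mul_eq_zero]
  apply Complex.ext <;> simp [conformalPart_apply, anticonformalPart_apply] <;> nlinarith

theorem HasTwoTraceForm.preservesTEAPairs {T : M2 →ₗ[ℝ] M2} (h : HasTwoTraceForm T) :
    PreservesTEAPairs T := by
  obtain ⟨F₁, hF₁, F₂, -, hF, Z₁, Z₂, hT⟩ := h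
  have hF₂ : F₂ = F₁ * !![0, 1; -1, 0] := by
    rw [← hF, ← mul_assoc]
    have h1 : F₁ * F₁ᵀ = 1 := (Matrix.mem_orthogonalGroup_iff _ _).1 hF₁
    rw [h1, one_mul]
  -- Conformal and anticonformal matrices are orthogonal for `trace (F * X)`, and `F₂`, being `F₁`
  -- times a rotation, has the same type as `F₁`. So both traces see only one part of `X`.
  rcases parts_of_mem_orthogonalGroup hF₁ with h0 | h0
  · refine preservesTEAPairs_of_eq_comp_conformalPart (T ∘ₗ ofConformal) ?_
    have hre := congrArg Complex.re h0
    have him := congrArg Complex.im h0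
    simp [anticonformalPart_apply] at hre him
    ext1 X
    simp only [LinearMap.comp_apply]
    rw [hT, hT, hF₂]
    congr 2 <;> simp [Matrix.trace, Matrix.mul_apply, Fin.sum_univ_two, conformalPart_apply,
      ofConformal_apply]
    · linear_combination (X 0 0 - X 1 1) / 2 * hre + (X 0 1 + X 1 0) / 2 * him
    · linear_combination (X 1 0 + X 0 1) / 2 * hre - (X 0 0 - X 1 1) / 2 * him
  · refine preservesTEAPairs_of_eq_comp_anticonformalPart (T ∘ₗ ofAnticonformal) ?_
    have hre := congrArg Complex.re h0
    have him := congrArg Complex.im h0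
    simp [conformalPart_apply] at hre him
    ext1 X
    simp only [LinearMap.comp_apply]
    rw [hT, hT, hF₂]
    congr 2 <;> simp [Matrix.trace, Matrix.mul_apply, Fin.sum_univ_two, anticonformalPart_apply,
      ofAnticonformal_apply]
    · linear_combination (X 0 0 + X 1 1) / 2 * hre + (X 0 1 - X 1 0) / 2 * him
    · linear_combination (X 1 0 - X 0 1) / 2 * hre + (X 0 0 + X 1 1) / 2 * him

/-! ### Maps vanishing on one plane -/

theorem hasTwoTraceForm_of_ofAnticonformal_eq_zero {T : M2 →ₗ[ℝ] M2}
    (h : T ∘ₗ ofAnticonformal = 0) : HasTwoTraceForm T := by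
  refine ⟨1, one_mem _, !![0, 1; -1, 0], ?_, by simp, (1 / 2 : ℝ) • T (ofConformal 1),
    (1 / 2 : ℝ) • T (ofConformal Complex.I), fun X => ?_⟩
  · rw [Matrix.mem_orthogonalGroup_iff]
    ext i j
    fin_cases i <;> fin_cases j <;> simp [Matrix.mul_apply]
  · have h0 : T (ofAnticonformal (anticonformalPart X)) = 0 := LinearMap.congr_fun h _
    conv_lhs => rw [← ofConformal_add_ofAnticonformal X, map_add, h0, add_zero]
    have hX : conformalPart X = (1 * X : M2).trace • (1 / 2 : ℝ) • (1 : ℂ) +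
        (!![0, 1; -1, 0] * X : M2).trace • (1 / 2 : ℝ) • Complex.I := by
      apply Complex.ext <;> simp [conformalPart_apply, Matrix.trace, Matrix.vecMul, dotProduct,
        Fin.sum_univ_two] <;> ring
    rw [hX]
    simp only [map_add, map_smul]

theorem reflection_mem : (!![1, 0; 0, -1] : M2) ∈ Matrix.orthogonalGroup (Fin 2) ℝ := by
  rw [Matrix.mem_orthogonalGroup_iff]
  ext i j
  fin_cases i <;> fin_cases j <;> simp [Matrix.mul_apply]

theorem hasTwoTraceForm_of_ofConformal_eq_zero {T : M2 →ₗ[ℝ] M2}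
    (h : T ∘ₗ ofConformal = 0) : HasTwoTraceForm T := by
  refine ⟨!![1, 0; 0, -1], reflection_mem, !![0, 1; 1, 0], ?_, ?_,
    (1 / 2 : ℝ) • T (ofAnticonformal 1),
    (1 / 2 : ℝ) • T (ofAnticonformal Complex.I), fun X => ?_⟩
  · rw [Matrix.mem_orthogonalGroup_iff]
    ext i j
    fin_cases i <;> fin_cases j <;> simp [Matrix.mul_apply]
  · ext i j
    fin_cases i <;> fin_cases j <;> simp [Matrix.mul_apply]
  · have h0 : T (ofConformal (conformalPart X)) = 0 := LinearMap.congr_fun h _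
    conv_lhs => rw [← ofConformal_add_ofAnticonformal X, map_add, h0, zero_add]
    have hX : anticonformalPart X = (!![1, 0; 0, -1] * X : M2).trace • (1 / 2 : ℝ) • (1 : ℂ) +
        (!![0, 1; 1, 0] * X : M2).trace • (1 / 2 : ℝ) • Complex.I := by
      apply Complex.ext <;> simp [anticonformalPart_apply, Matrix.trace, Matrix.vecMul, dotProduct,
        Fin.sum_univ_two] <;> ring
    rw [hX]
    simp only [map_add, map_smul]

/-! ### Diagonal maps in the basis `R` -/

theorem toMatrix_basisR_eq_diagonal_iff (S : M2 →ₗ[ℝ] M2) (d : Fin 4 → ℝ) :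
    LinearMap.toMatrix basisR basisR S = Matrix.diagonal d ↔
      ∀ j, S (familyR j) = d j • familyR j := by
  have hb : ∀ j, basisR j = familyR j := fun j => by simp [basisR]
  have hS : LinearMap.toMatrix basisR basisR S = Matrix.diagonal d ↔
      ∀ j, basisR.repr (S (basisR j)) = d j • basisR.repr (basisR j) := by
    rw [← Matrix.ext_iff, forall_comm]
    refine forall_congr' fun j => ?_
    rw [DFunLike.ext_iff]
    refine forall_congr' fun i => ?_
    rw [LinearMap.toMatrix_apply]
    simp only [Matrix.diagonal_apply, Finsupp.smul_apply, Module.Basis.repr_self,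
      Finsupp.single_apply, smul_eq_mul, mul_ite, mul_one, mul_zero]
    by_cases hij : i = j
    · subst hij; simp
    · simp [hij, Ne.symm hij]
  rw [hS]
  refine forall_congr' fun j => ?_
  rw [← map_smul, basisR.repr.injective.eq_iff, hb]

theorem familyR_zero : familyR 0 = (1 / √2 : ℝ) • ofConformal 1 := by
  simp [familyR, ofConformal_apply]

theorem familyR_one : familyR 1 = (1 / √2 : ℝ) • ofAnticonformal 1 := by
  simp [familyR, ofAnticonformal_apply]

theorem familyR_two : familyR 2 = (1 / √2 : ℝ) • ofAnticonformal Complex.I := by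
  simp [familyR, ofAnticonformal_apply]

theorem familyR_three : familyR 3 = -(1 / √2 : ℝ) • ofConformal Complex.I := by
  simp [familyR, ofConformal_apply]

/-- Up to nonzero scalars, indices 0 and 3 are `1` and `i` in the conformal plane, and 1 and 2 are
`1` and `i` in the anticonformal plane. -/
theorem toMatrix_basisR_eq_diagonal_iff' (S : M2 →ₗ[ℝ] M2) (d : Fin 4 → ℝ) :
    LinearMap.toMatrix basisR basisR S = Matrix.diagonal d ↔
      S (ofConformal 1) = d 0 • ofConformal 1 ∧
      S (ofAnticonformal 1) = d 1 • ofAnticonformal 1 ∧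
      S (ofAnticonformal Complex.I) = d 2 • ofAnticonformal Complex.I ∧
      S (ofConformal Complex.I) = d 3 • ofConformal Complex.I := by
  have h2 : (1 / √2 : ℝ) ≠ 0 := by positivity
  have h2' : -(1 / √2 : ℝ) ≠ 0 := neg_ne_zero.2 h2
  rw [toMatrix_basisR_eq_diagonal_iff]
  simp only [Fin.forall_fin_succ, Fin.succ_zero_eq_one, Fin.succ_one_eq_two, IsEmpty.forall_iff,
    and_true]
  have h3 : (Fin.succ 2 : Fin 4) = 3 := rfl
  rw [h3, familyR_zero, familyR_one, familyR_two, familyR_three]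
  simp only [map_smul, smul_comm (d _) (1 / √2 : ℝ), smul_comm (d _) (-(1 / √2) : ℝ)]
  rw [(smul_right_injective M2 h2).eq_iff, (smul_right_injective M2 h2).eq_iff,
    (smul_right_injective M2 h2).eq_iff, (smul_right_injective M2 h2').eq_iff]

theorem norm_orthogonal_mul_mul {U V : M2} (hU : U ∈ Matrix.orthogonalGroup (Fin 2) ℝ)
    (hV : V ∈ Matrix.orthogonalGroup (Fin 2) ℝ) (A : M2) : ‖U * A * V‖ = ‖A‖ := by
  rw [CStarRing.norm_mul_mem_unitary _ hV, CStarRing.norm_mem_unitary_mul _ hU]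

theorem isTEAPair_orthogonal_mul_mul_iff {U V : M2} (hU : U ∈ Matrix.orthogonalGroup (Fin 2) ℝ)
    (hV : V ∈ Matrix.orthogonalGroup (Fin 2) ℝ) (A B : M2) :
    IsTEAPair (U * A * V) (U * B * V) ↔ IsTEAPair A B := by
  rw [IsTEAPair, IsTEAPair, ← add_mul, ← mul_add, norm_orthogonal_mul_mul hU hV,
    norm_orthogonal_mul_mul hU hV, norm_orthogonal_mul_mul hU hV]

/-- A map respecting the decomposition into conformal and anticonformal parts preserves TEA
pairs. -/
theorem preservesTEAPairs_of_blocks {S : M2 →ₗ[ℝ] M2} (P Q : ℂ →ₗ[ℝ] ℂ)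
    (hP : ∀ A, conformalPart (S A) = P (conformalPart A))
    (hQ : ∀ A, anticonformalPart (S A) = Q (anticonformalPart A)) : PreservesTEAPairs S := by
  intro A B hAB
  rw [isTEAPair_iff_sameRay] at hAB ⊢
  rw [hP, hP, hQ, hQ]
  exact ⟨hAB.1.map P, hAB.2.map Q⟩

theorem preservesTEAPairs_of_diagonal {S : M2 →ₗ[ℝ] M2} {d : Fin 4 → ℝ}
    (h : LinearMap.toMatrix basisR basisR S = Matrix.diagonal d) : PreservesTEAPairs S := by
  obtain ⟨h0, h1, h2, h3⟩ := (toMatrix_basisR_eq_diagonal_iff' S d).1 h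
  have hP : anticonformalPart ∘ₗ S ∘ₗ ofConformal = 0 :=
    Complex.basisOneI.ext fun i => by fin_cases i <;> simp [h0, h3]
  have hQ : conformalPart ∘ₗ S ∘ₗ ofAnticonformal = 0 :=
    Complex.basisOneI.ext fun i => by fin_cases i <;> simp [h1, h2]
  refine preservesTEAPairs_of_blocks (conformalPart ∘ₗ S ∘ₗ ofConformal)
    (anticonformalPart ∘ₗ S ∘ₗ ofAnticonformal) (fun A => ?_) (fun A => ?_)
  · conv_lhs => rw [← ofConformal_add_ofAnticonformal A, map_add, map_add]
    simpa using LinearMap.congr_fun hQ (anticonformalPart A)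
  · conv_lhs => rw [← ofConformal_add_ofAnticonformal A, map_add, map_add]
    simpa using LinearMap.congr_fun hP (conformalPart A)

theorem HasDiagonalForm.preservesTEAPairs {T : M2 →ₗ[ℝ] M2} (h : HasDiagonalForm T) :
    PreservesTEAPairs T := by
  obtain ⟨U₁, hU₁, U₂, hU₂, V₁, hV₁, V₂, hV₂, d, hd⟩ := h
  intro A B hAB
  have hA : ∀ X : M2, U₂ * (star U₂ * X * star V₂) * V₂ = X := fun X => by
    have h1 : U₂ * star U₂ = 1 := (Matrix.mem_orthogonalGroup_iff _ _).1 hU₂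
    have h2 : star V₂ * V₂ = 1 := (Matrix.mem_orthogonalGroup_iff' _ _).1 hV₂
    calc U₂ * (star U₂ * X * star V₂) * V₂ = (U₂ * star U₂) * X * (star V₂ * V₂) := by
          simp only [mul_assoc]
      _ = X := by rw [h1, h2, one_mul, mul_one]
  have := preservesTEAPairs_of_diagonal hd (star U₂ * A * star V₂) (star U₂ * B * star V₂)
    ((isTEAPair_orthogonal_mul_mul_iff (Unitary.star_mem hU₂) (Unitary.star_mem hV₂) _ _).2 hAB)
  rwa [modifiedMap_apply, modifiedMap_apply, hA, hA,
    isTEAPair_orthogonal_mul_mul_iff hU₁ hV₁] at this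

/-! ### Rotations and diagonalization of the blocks -/

/-- The rotation by the angle `θ`. -/
noncomputable def planeRotation (θ : ℝ) : M2 := ofConformal (Complex.exp (θ * Complex.I))

theorem planeRotation_mem (θ : ℝ) : planeRotation θ ∈ Matrix.orthogonalGroup (Fin 2) ℝ := by
  rw [Matrix.mem_orthogonalGroup_iff]
  have h := Real.cos_sq_add_sin_sq θ
  ext i j
  fin_cases i <;> fin_cases j <;>
    simp [planeRotation, ofConformal_apply, Matrix.mul_apply, Fin.sum_univ_two,
      Complex.exp_ofReal_mul_I_re, Complex.exp_ofReal_mul_I_im] <;> linarith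

theorem conformalPart_ofConformal_mul_mul (z w : ℂ) (A : M2) :
    conformalPart (ofConformal z * A * ofConformal w) = z * w * conformalPart A := by
  apply Complex.ext <;>
    simp [conformalPart_apply, ofConformal_apply, Matrix.mul_apply, Matrix.vecMul, dotProduct,
      Fin.sum_univ_two] <;> ring

theorem anticonformalPart_ofConformal_mul_mul (z w : ℂ) (A : M2) :
    anticonformalPart (ofConformal z * A * ofConformal w) =
      z * conj w * anticonformalPart A := by
  apply Complex.ext <;>
    simp [anticonformalPart_apply, ofConformal_apply, Matrix.mul_apply, Matrix.vecMul, dotProduct,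
      Fin.sum_univ_two] <;> ring

/-- Any pair of rotations of the two parts comes from multiplication by rotations. -/
theorem exists_orthogonal_rotating_parts (θ φ : ℝ) :
    ∃ U ∈ Matrix.orthogonalGroup (Fin 2) ℝ, ∃ V ∈ Matrix.orthogonalGroup (Fin 2) ℝ, ∀ A : M2,
      conformalPart (U * A * V) = Complex.exp (θ * Complex.I) * conformalPart A ∧
      anticonformalPart (U * A * V) = Complex.exp (φ * Complex.I) * anticonformalPart A := by
  -- Rotations by `a` on the left and `b` on the right turn the two parts by `a + b` and `a - b`.
  refine ⟨_, planeRotation_mem ((θ + φ) / 2), _, planeRotation_mem ((θ - φ) / 2), fun A => ?_⟩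
  rw [planeRotation, planeRotation, conformalPart_ofConformal_mul_mul,
    anticonformalPart_ofConformal_mul_mul, ← Complex.exp_conj, ← Complex.exp_add,
    ← Complex.exp_add, map_mul, Complex.conj_I, Complex.conj_ofReal]
  constructor <;> (congr 2; push_cast; ring)

/-- Singular value decomposition of a real linear map of the plane, by rotations. -/
theorem exists_rotations_diagonalizing (P : ℂ →ₗ[ℝ] ℂ) :
    ∃ θ φ x y : ℝ,
      Complex.exp (θ * Complex.I) * P (Complex.exp (φ * Complex.I) * 1) = x • 1 ∧
      Complex.exp (θ * Complex.I) * P (Complex.exp (φ * Complex.I) * Complex.I) =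
        y • Complex.I := by
  obtain ⟨γ, δ, hP⟩ : ∃ γ δ : ℂ, ∀ z, P z = γ * z + δ * conj z := by
    refine ⟨(P 1 - Complex.I * P Complex.I) / 2, (P 1 + Complex.I * P Complex.I) / 2,
      fun z => ?_⟩
    have hz : P z = z.re * P 1 + z.im * P Complex.I := by
      conv_lhs => rw [show z = z.re • (1 : ℂ) + z.im • Complex.I by
        apply Complex.ext <;> simp]
      rw [map_add, map_smul, map_smul, Complex.real_smul, Complex.real_smul]
    have hI := Complex.I_mul_I
    conv_rhs => rw [← Complex.re_add_im z]
    rw [hz, map_add, map_mul, Complex.conj_I, Complex.conj_ofReal, Complex.conj_ofReal]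
    linear_combination ((z.im : ℂ) * P Complex.I) * hI
  have hγ := Complex.norm_mul_exp_arg_mul_I γ
  have hδ := Complex.norm_mul_exp_arg_mul_I δ
  -- These angles cancel the arguments of `γ` and `δ` simultaneously, leaving real coefficients.
  have key : ∀ z, Complex.exp ((-(γ.arg + δ.arg) / 2 : ℝ) * Complex.I) *
      P (Complex.exp (((δ.arg - γ.arg) / 2 : ℝ) * Complex.I) * z) =
      ‖γ‖ * z + ‖δ‖ * conj z := fun z => by
    have e1 : Complex.exp ((-(γ.arg + δ.arg) / 2 : ℝ) * Complex.I) *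
        Complex.exp (γ.arg * Complex.I) *
        Complex.exp (((δ.arg - γ.arg) / 2 : ℝ) * Complex.I) = 1 := by
      rw [← Complex.exp_add, ← Complex.exp_add, ← Complex.exp_zero]
      congr 1; push_cast; ring
    have e2 : Complex.exp ((-(γ.arg + δ.arg) / 2 : ℝ) * Complex.I) *
        Complex.exp (δ.arg * Complex.I) *
        Complex.exp (((δ.arg - γ.arg) / 2 : ℝ) * -Complex.I) = 1 := by
      rw [← Complex.exp_add, ← Complex.exp_add, ← Complex.exp_zero]
      congr 1; push_cast; ring
    rw [hP, map_mul, ← Complex.exp_conj, map_mul, Complex.conj_I, Complex.conj_ofReal]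
    linear_combination (‖γ‖ * z) * e1 + (‖δ‖ * conj z) * e2 -
      (Complex.exp ((-(γ.arg + δ.arg) / 2 : ℝ) * Complex.I) *
        Complex.exp (((δ.arg - γ.arg) / 2 : ℝ) * Complex.I) * z) * hγ -
      (Complex.exp ((-(γ.arg + δ.arg) / 2 : ℝ) * Complex.I) *
        Complex.exp (((δ.arg - γ.arg) / 2 : ℝ) * -Complex.I) * conj z) * hδ
  refine ⟨_, _, ‖γ‖ + ‖δ‖, ‖γ‖ - ‖δ‖, (key 1).trans ?_, (key Complex.I).trans ?_⟩
  · simp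
  · simp; ring

theorem hasDiagonalForm_of_blocks {T : M2 →ₗ[ℝ] M2}
    (hP : anticonformalPart ∘ₗ T ∘ₗ ofConformal = 0)
    (hQ : conformalPart ∘ₗ T ∘ₗ ofAnticonformal = 0) : HasDiagonalForm T := by
  obtain ⟨θ, φ, x, y, hx, hy⟩ := exists_rotations_diagonalizing (conformalPart ∘ₗ T ∘ₗ ofConformal)
  obtain ⟨θ', φ', x', y', hx', hy'⟩ :=
    exists_rotations_diagonalizing (anticonformalPart ∘ₗ T ∘ₗ ofAnticonformal)
  obtain ⟨U₁, hU₁, V₁, hV₁, h₁⟩ := exists_orthogonal_rotating_parts θ θ'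
  obtain ⟨U₂, hU₂, V₂, hV₂, h₂⟩ := exists_orthogonal_rotating_parts φ φ'
  refine ⟨U₁, hU₁, U₂, hU₂, V₁, hV₁, V₂, hV₂, ![x, x', y', y], ?_⟩
  have hp : ∀ z, U₂ * ofConformal z * V₂ =
      ofConformal (Complex.exp (φ * Complex.I) * z) := fun z =>
    M2.ext_parts (by simp [h₂]) (by simp [h₂])
  have hq : ∀ z, U₂ * ofAnticonformal z * V₂ =
      ofAnticonformal (Complex.exp (φ' * Complex.I) * z) := fun z =>
    M2.ext_parts (by simp [h₂]) (by simp [h₂])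
  have hP' : ∀ z, anticonformalPart (T (ofConformal z)) = 0 := LinearMap.congr_fun hP
  have hQ' : ∀ z, conformalPart (T (ofAnticonformal z)) = 0 := LinearMap.congr_fun hQ
  simp only [LinearMap.comp_apply] at hx hy hx' hy'
  rw [toMatrix_basisR_eq_diagonal_iff']
  simp only [modifiedMap_apply, hp, hq]
  refine ⟨M2.ext_parts ?_ ?_, M2.ext_parts ?_ ?_, M2.ext_parts ?_ ?_, M2.ext_parts ?_ ?_⟩
  · rw [(h₁ _).1, hx]; simp
  · rw [(h₁ _).2, hP']; simp
  · rw [(h₁ _).1, hQ']; simp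
  · rw [(h₁ _).2, hx']; simp
  · rw [(h₁ _).1, hQ']; simp
  · rw [(h₁ _).2, hy']; simp
  · rw [(h₁ _).1, hy]; simp
  · rw [(h₁ _).2, hP']; simp

/-- Right multiplication by a reflection exchanges the two parts, which reduces this to the
unswapped case. -/
theorem hasDiagonalForm_of_swapped_blocks {T : M2 →ₗ[ℝ] M2}
    (hP : conformalPart ∘ₗ T ∘ₗ ofConformal = 0)
    (hQ : anticonformalPart ∘ₗ T ∘ₗ ofAnticonformal = 0) : HasDiagonalForm T := by
  have hp : ∀ A : M2, conformalPart (A * !![1, 0; 0, -1]) = anticonformalPart A := fun A => by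
    apply Complex.ext <;>
      simp [conformalPart_apply, anticonformalPart_apply, Matrix.mul_apply, Fin.sum_univ_two,
        sub_eq_add_neg]
  have hq : ∀ A : M2, anticonformalPart (A * !![1, 0; 0, -1]) = conformalPart A := fun A => by
    apply Complex.ext <;>
      simp [conformalPart_apply, anticonformalPart_apply, Matrix.mul_apply, Fin.sum_univ_two,
        sub_eq_add_neg]
  obtain ⟨U₁, hU₁, U₂, hU₂, V₁, hV₁, V₂, hV₂, d, hd⟩ :=
    hasDiagonalForm_of_blocks (T := LinearMap.mulRight ℝ (!![1, 0; 0, -1] : M2) ∘ₗ T)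
      (by ext1 z; simpa [hq] using LinearMap.congr_fun hP z)
      (by ext1 z; simpa [hp] using LinearMap.congr_fun hQ z)
  refine ⟨U₁, hU₁, U₂, hU₂, _, mul_mem reflection_mem hV₁, V₂, hV₂, d, ?_⟩
  rw [← hd]
  congr 1
  ext1 A
  simp [modifiedMap_apply, mul_assoc]

theorem hasTwoTraceForm_or_hasDiagonalForm {T : M2 →ₗ[ℝ] M2}
    (h₁ : conformalPart ∘ₗ T ∘ₗ ofConformal = 0 ∨ conformalPart ∘ₗ T ∘ₗ ofAnticonformal = 0)
    (h₂ : anticonformalPart ∘ₗ T ∘ₗ ofConformal = 0 ∨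
      anticonformalPart ∘ₗ T ∘ₗ ofAnticonformal = 0) :
    HasTwoTraceForm T ∨ HasDiagonalForm T := by
  rcases h₁ with h₁ | h₁ <;> rcases h₂ with h₂ | h₂
  · exact Or.inl (hasTwoTraceForm_of_ofConformal_eq_zero (LinearMap.ext fun z =>
      M2.ext_parts (by simpa using LinearMap.congr_fun h₁ z)
        (by simpa using LinearMap.congr_fun h₂ z)))
  · exact Or.inr (hasDiagonalForm_of_swapped_blocks h₁ h₂)
  · exact Or.inr (hasDiagonalForm_of_blocks h₂ h₁)
  · exact Or.inl (hasTwoTraceForm_of_ofAnticonformal_eq_zero (LinearMap.ext fun z =>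
      M2.ext_parts (by simpa using LinearMap.congr_fun h₁ z)
        (by simpa using LinearMap.congr_fun h₂ z)))

/-! ### Classification of TEA preservers -/

/-- Both `L α` and `-L α` share a ray with `L β`; if `L β ≠ 0`, they share a ray with each other, so
`L α = 0`. -/
theorem comp_eq_zero_or_of_sameRay {L : M2 →ₗ[ℝ] ℂ}
    (h : ∀ A B, IsTEAPair A B → SameRay ℝ (L A) (L B)) :
    L ∘ₗ ofConformal = 0 ∨ L ∘ₗ ofAnticonformal = 0 := by
  by_contra! hne
  obtain ⟨α, hα⟩ := DFunLike.ne_iff.1 hne.1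
  obtain ⟨β, hβ⟩ := DFunLike.ne_iff.1 hne.2
  simp only [LinearMap.comp_apply, LinearMap.zero_apply] at hα hβ
  have h1 := h _ _ (isTEAPair_ofConformal_ofAnticonformal (α := α) (β := β))
  have h2 := h _ _ (isTEAPair_ofConformal_ofAnticonformal (α := -α) (β := β))
  rw [map_neg, map_neg] at h2
  have h3 := h1.trans h2.symm fun h0 => (hβ h0).elim
  exact hα (eq_zero_of_sameRay_self_neg h3)

theorem PreservesTEAPairs.hasForm {T : M2 →ₗ[ℝ] M2} (h : PreservesTEAPairs T) :
    HasTwoTraceForm T ∨ HasDiagonalForm T :=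
  hasTwoTraceForm_or_hasDiagonalForm
    (comp_eq_zero_or_of_sameRay (L := conformalPart ∘ₗ T)
      fun A B hAB => ((isTEAPair_iff_sameRay _ _).1 (h A B hAB)).1)
    (comp_eq_zero_or_of_sameRay (L := anticonformalPart ∘ₗ T)
      fun A B hAB => ((isTEAPair_iff_sameRay _ _).1 (h A B hAB)).2)

/-! ### Classification of parallel-pair preservers -/

/-- If `u ≠ 0` and `u`, `μ v` lie on a ray with `μ` of modulus one, then `v` is a multiple
of `u`. -/
theorem exists_eq_smul_of_sameRay {u v : ℂ} {μ : ℝ} (hμ : ‖μ‖ = 1) (hu : u ≠ 0)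
    (h : SameRay ℝ u (μ • v)) : ∃ c : ℝ, v = c • u := by
  have hμ0 : μ ≠ 0 := fun h0 => by simp [h0] at hμ
  obtain ⟨r, -, hr⟩ := h.exists_nonneg_left hu
  exact ⟨μ⁻¹ * r, by rw [mul_smul, hr, inv_smul_smul₀ hμ0]⟩

theorem isTEAPair_combination {α β : ℂ} {s t s' t' : ℝ} (hs : 0 ≤ s) (ht : 0 ≤ t) (hs' : 0 ≤ s')
    (ht' : 0 ≤ t') :
    IsTEAPair (s • ofConformal α + t • ofAnticonformal β)
      (s' • ofConformal α + t' • ofAnticonformal β) := by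
  rw [isTEAPair_iff_sameRay]
  constructor
  · simpa using ((SameRay.refl α).nonneg_smul_left hs).nonneg_smul_right hs'
  · simpa using ((SameRay.refl β).nonneg_smul_left ht).nonneg_smul_right ht'

/-- Pairing a vector of one plane with a vector of the other shows that `L` has rank one, `L = f •
u`. For `M`, it is enough that `M` agrees on any `α` and `β` with `f = 1`; nearly cancelling
combinations of these show it. -/
theorem exists_common_functional {L M : M2 →ₗ[ℝ] ℂ}
    (h : ∀ A B, IsTEAPair A B →
      ∃ μ : ℝ, ‖μ‖ = 1 ∧ SameRay ℝ (L A) (μ • L B) ∧ SameRay ℝ (M A) (μ • M B))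
    (hp : L ∘ₗ ofConformal ≠ 0) (hq : L ∘ₗ ofAnticonformal ≠ 0) :
    ∃ (f : M2 →ₗ[ℝ] ℝ) (u v : ℂ), (∀ A, L A = f A • u) ∧ ∀ A, M A = f A • v := by
  obtain ⟨α₀, hα₀⟩ := DFunLike.ne_iff.1 hp
  obtain ⟨β₀, hβ₀⟩ := DFunLike.ne_iff.1 hq
  simp only [LinearMap.comp_apply, LinearMap.zero_apply] at hα₀ hβ₀
  set u := L (ofConformal α₀) with hu
  have hLq : ∀ β, ∃ c : ℝ, L (ofAnticonformal β) = c • u := fun β => by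
    obtain ⟨μ, hμ, h1, -⟩ := h _ _ (isTEAPair_ofConformal_ofAnticonformal (α := α₀) (β := β))
    exact exists_eq_smul_of_sameRay hμ hα₀ h1
  have hLp : ∀ α, ∃ c : ℝ, L (ofConformal α) = c • u := fun α => by
    have hTEA : IsTEAPair (ofAnticonformal β₀) (ofConformal α) := by
      simp [isTEAPair_iff_sameRay]
    obtain ⟨μ, hμ, h1, -⟩ := h _ _ hTEA
    obtain ⟨c, hc⟩ := exists_eq_smul_of_sameRay hμ hβ₀ h1
    obtain ⟨c', hc'⟩ := hLq β₀
    exact ⟨c * c', by rw [hc, hc', mul_smul]⟩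
  let f : M2 →ₗ[ℝ] ℝ := Complex.reLm ∘ₗ LinearMap.mulLeft ℝ u⁻¹ ∘ₗ L
  have hf : ∀ (A : M2) (c : ℝ), L A = c • u → f A = c := fun A c hc => by
    simp [f, hc, mul_left_comm, hα₀]
  have hfp : ∀ α, L (ofConformal α) = f (ofConformal α) • u := fun α => by
    obtain ⟨c, hc⟩ := hLp α
    rw [hf _ _ hc, hc]
  have hfq : ∀ β, L (ofAnticonformal β) = f (ofAnticonformal β) • u := fun β => by
    obtain ⟨c, hc⟩ := hLq β
    rw [hf _ _ hc, hc]
  have hfL : ∀ A, L A = f A • u := fun A => by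
    rw [← ofConformal_add_ofAnticonformal A, map_add, map_add, hfp, hfq, add_smul]
  have hM : ∀ α β, f (ofConformal α) = 1 → f (ofAnticonformal β) = 1 →
      M (ofConformal α) = M (ofAnticonformal β) := fun α β hα hβ => by
    have hLα : L (ofConformal α) = u := by rw [hfp, hα, one_smul]
    have hLβ : L (ofAnticonformal β) = u := by rw [hfq, hβ, one_smul]
    set w := M (ofConformal α) - M (ofAnticonformal β) with hw
    have hbound : ∀ ε : ℝ, 0 < ε → ε ≤ 1 → ‖w‖ ≤ ε * ‖M (ofAnticonformal β)‖ := by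
      intro ε hε hε1
      -- The pair `α - (1 ∓ ε) β` is TEA, while `L` sends it to `± ε u`, which forces `μ = -1`.
      obtain ⟨μ, hμ, h1, h2⟩ := h _ _ (isTEAPair_combination (α := α) (β := -β) (s := 1)
        (t := 1 - ε) (s' := 1) (t' := 1 + ε) zero_le_one (by linarith) zero_le_one (by linarith))
      simp only [map_add, map_smul, map_neg, one_smul, hLα, hLβ] at h1 h2
      have hμ' : μ = -1 := by
        rcases (abs_eq zero_le_one).1 hμ with h0 | h0
        · exfalso
          rw [h0] at h1
          have e1 : u + (1 - ε) • -u = ε • u := by module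
          have e2 : (1 : ℝ) • (u + (1 + ε) • -u) = -(ε • u) := by module
          rw [e1, e2] at h1
          exact smul_ne_zero hε.ne' hα₀ (eq_zero_of_sameRay_self_neg h1)
        · exact h0
      rw [hμ'] at h2
      set q := M (ofAnticonformal β) with hqdef
      have e1 : M (ofConformal α) + (1 - ε) • -q = w + ε • q := by rw [hw]; module
      have e2 : (-1 : ℝ) • (M (ofConformal α) + (1 + ε) • -q) = ε • q - w := by rw [hw]; module
      rw [e1, e2] at h2
      -- The vectors `w + ε q` and `ε q - w` share a ray, so their sum `2 ε q` is at least as long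
      -- as their difference `2 w`.
      have e3 := h2.norm_add
      have e4 : w + ε • q + (ε • q - w) = (2 * ε) • q := by module
      have e5 : ‖(2 : ℝ) • w‖ ≤ ‖w + ε • q‖ + ‖ε • q - w‖ := by
        have : (2 : ℝ) • w = (w + ε • q) - (ε • q - w) := by module
        rw [this]
        exact norm_sub_le _ _
      rw [e4, norm_smul, Real.norm_of_nonneg (by positivity)] at e3
      rw [norm_smul, Real.norm_of_nonneg (by positivity)] at e5
      linarith
    have hw0 : w = 0 := by
      rw [← norm_le_zero_iff]
      have hlim : Filter.Tendsto (fun ε : ℝ => ε * ‖M (ofAnticonformal β)‖)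
          (nhdsWithin 0 (Set.Ioi 0)) (nhds 0) := by
        have : Continuous fun ε : ℝ => ε * ‖M (ofAnticonformal β)‖ := by fun_prop
        simpa using (this.tendsto 0).mono_left nhdsWithin_le_nhds
      refine ge_of_tendsto hlim ?_
      filter_upwards [Ioc_mem_nhdsGT zero_lt_one] with ε hε
      exact hbound ε hε.1 hε.2
    exact sub_eq_zero.1 hw0
  have hfα₀ : f (ofConformal α₀) = 1 := hf _ _ (one_smul _ _).symm
  have hfβ₀ : f (ofAnticonformal β₀) ≠ 0 := fun h0 => hβ₀ (by rw [hfq, h0, zero_smul])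
  set β₁ := (f (ofAnticonformal β₀))⁻¹ • β₀
  have hfβ₁ : f (ofAnticonformal β₁) = 1 := by
    rw [map_smul, map_smul, smul_eq_mul, inv_mul_cancel₀ hfβ₀]
  have h01 := hM _ _ hfα₀ hfβ₁
  refine ⟨f, u, M (ofConformal α₀), hfL, fun A => ?_⟩
  have hMp : ∀ α, M (ofConformal α) = f (ofConformal α) • M (ofConformal α₀) := fun α => by
    -- Adding a multiple of `α₀` normalizes the value of `f` to 1.
    have := hM (α + (1 - f (ofConformal α)) • α₀) β₁ (by
      rw [map_add, map_add, map_smul, map_smul, hfα₀, smul_eq_mul]; ring) hfβ₁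
    rw [map_add, map_add, map_smul, map_smul, ← h01] at this
    rw [eq_sub_of_add_eq this]
    module
  have hMq : ∀ β, M (ofAnticonformal β) = f (ofAnticonformal β) • M (ofConformal α₀) := fun β => by
    have := hM α₀ (β + (1 - f (ofAnticonformal β)) • β₁) hfα₀ (by
      rw [map_add, map_add, map_smul, map_smul, hfβ₁, smul_eq_mul]; ring)
    rw [map_add, map_add, map_smul, map_smul, ← h01] at this
    rw [eq_sub_of_add_eq this.symm]
    module
  rw [← ofConformal_add_ofAnticonformal A, map_add, map_add, hMp, hMq, add_smul]

theorem exists_trace_form (f : M2 →ₗ[ℝ] ℝ) : ∃ F : M2, ∀ A, f A = (F * A).trace := by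
  refine ⟨Matrix.of fun i j => f (Matrix.single j i 1), fun A => ?_⟩
  conv_lhs => rw [Matrix.matrix_eq_sum_single A]
  have hs : ∀ i j, Matrix.single i j (A i j) = A i j • Matrix.single i j (1 : ℝ) := fun i j => by
    simp
  simp only [hs, map_sum, map_smul]
  simp [Matrix.trace, Matrix.mul_apply, Fin.sum_univ_two]
  ring

theorem hasOneTraceForm_of_parts {T : M2 →ₗ[ℝ] M2} (f : M2 →ₗ[ℝ] ℝ) (u v : ℂ)
    (hu : ∀ A, conformalPart (T A) = f A • u) (hv : ∀ A, anticonformalPart (T A) = f A • v) :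
    HasOneTraceForm T := by
  obtain ⟨F, hF⟩ := exists_trace_form f
  refine ⟨F, ofConformal u + ofAnticonformal v, fun A => ?_⟩
  rw [← hF]
  exact M2.ext_parts (by simp [hu]) (by simp [hv])

theorem PreservesParallelPairs.hasForm {T : M2 →ₗ[ℝ] M2} (h : PreservesParallelPairs T) :
    HasTwoTraceForm T ∨ HasDiagonalForm T ∨ HasOneTraceForm T := by
  have hTEA : ∀ A B, IsTEAPair A B → ∃ μ : ℝ, ‖μ‖ = 1 ∧
      SameRay ℝ (conformalPart (T A)) (μ • conformalPart (T B)) ∧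
      SameRay ℝ (anticonformalPart (T A)) (μ • anticonformalPart (T B)) := fun A B hAB => by
    obtain ⟨μ, hμ, hT⟩ := (isParallelPair_iff _ _).1
      (h A B ((isParallelPair_iff _ _).2 ⟨1, by simp, by rwa [one_smul]⟩))
    rw [isTEAPair_iff_sameRay, map_smul, map_smul] at hT
    exact ⟨μ, hμ, hT⟩
  by_cases h₁ : conformalPart ∘ₗ T ∘ₗ ofConformal = 0 ∨ conformalPart ∘ₗ T ∘ₗ ofAnticonformal = 0
  · by_cases h₂ : anticonformalPart ∘ₗ T ∘ₗ ofConformal = 0 ∨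
        anticonformalPart ∘ₗ T ∘ₗ ofAnticonformal = 0
    · exact (hasTwoTraceForm_or_hasDiagonalForm h₁ h₂).imp_right Or.inl
    · push Not at h₂
      obtain ⟨f, u, v, hu, hv⟩ := exists_common_functional (L := anticonformalPart ∘ₗ T)
        (M := conformalPart ∘ₗ T)
        (fun A B hAB => (hTEA A B hAB).imp fun μ hμ => ⟨hμ.1, hμ.2.2, hμ.2.1⟩) h₂.1 h₂.2
      exact Or.inr (Or.inr (hasOneTraceForm_of_parts f v u hv hu))
  · push Not at h₁
    obtain ⟨f, u, v, hu, hv⟩ := exists_common_functional (L := conformalPart ∘ₗ T)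
      (M := anticonformalPart ∘ₗ T) hTEA h₁.1 h₁.2
    exact Or.inr (Or.inr (hasOneTraceForm_of_parts f u v hu hv))

theorem theorem1p3 (T : M2 →ₗ[ℝ] M2) :
    (PreservesTEAPairs T ↔ HasTwoTraceForm T ∨ HasDiagonalForm T) ∧
    (PreservesParallelPairs T ↔ HasTwoTraceForm T ∨ HasDiagonalForm T ∨ HasOneTraceForm T) := by
  refine ⟨⟨PreservesTEAPairs.hasForm, ?_⟩, ⟨PreservesParallelPairs.hasForm, ?_⟩⟩
  · rintro (h | h)
    · exact h.preservesTEAPairs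
    · exact h.preservesTEAPairs
  · rintro (h | h | h)
    · exact h.preservesTEAPairs.preservesParallelPairs
    · exact h.preservesTEAPairs.preservesParallelPairs
    · exact h.preservesParallelPairs
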